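/- A \emph{presentation of a weak solenoid} is a sequence $\mathcal{P}=\{p_{\ell+1}\colon M_{\ell+1}\to M_\ell \mid \ell\ge 0\}$ in which the $M_\ell$ are connected compact manifolds without boundary, all of the same dimension, and each $p_{\ell+1}$ is a covering map of finite degree $m_{\ell+1}>1$. Its \emph{weak solenoid} is the inverse limit $$\mathcal{S}_{\mathcal P}=\Big\{(x_\ell)\in\prod_{\ell\ge0}M_\ell \;\Big|\; p_{\ell+1}(x_{\ell+1})=x_\ell \text{ for all } \ell\ge 0\Big\}$$ with the topology induced from the product, and $\Pi_0\colon\mathcal{S}_{\mathcal P}\to M_0$ is the projection. For $x_0\in M_0$ the group $\pi_1(M_0,x_0)$ acts by homeomorphisms on the fiber $\Pi_0^{-1}(x_0)$ by monodromy, that is, through its monodromy actions on the fibers over $x_0$ of the coverings $M_\ell\to M_0$. If $p_0'\colon M_0'\to M_0$ is a connected finite covering and $x_0'\in M_0'$ satisfies $p_0'(x_0')=x_0$, the pull-back $\mathcal{S}_{\mathcal P}'=M_0'\times_{M_0}\mathcal{S}_{\mathcal P}$ is the inverse limit of the coverings $M_0'\times_{M_0}M_\ell$ of $M_0'$, and in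 the same way $\pi_1(M_0',x_0')$ acts by monodromy on the fiber $\mathfrak{X}_0'$ of $\mathcal{S}_{\mathcal P}'\to M_0'$ over $x_0'$; write $\Phi'\colon\pi_1(M_0',x_0')\to\mathrm{Homeo}(\mathfrak{X}_0')$ for this action. The weak solenoid $\mathcal{S}_{\mathcal P}$ is \emph{virtually nilpotent} (respectively \emph{virtually abelian}) with respect to $x_0\in M_0$ if there is a subgroup $H_0'\subset\pi_1(M_0,x_0)$ of finite index such that, for the pointed connected covering $p_0'\colon(M_0',x_0')\to(M_0,x_0)$ with $(p_0')_\#\,\pi_1(M_0',x_0')=H_0'$, the image $\Phi'(\pi_1(M_0',x_0'))\subset\mathrm{Homeo}(\mathfrak{X}_0')$ is a nilpotent (respectively abelian) group. \textbf{Proposition.} Let $\mathcal{S}_{\mathcal P}$ and $\mathcal{S}_{\mathcal Q}$ be weak solenoids defined by presentations $\mathcal P$ and $\mathcal Q$ with base manifolds $M_0$ and $N_0$, and suppose that $\mathcal{S}_{\mathcal P}$ and $\mathcal{S}_{\mathcal Q}$ are homeomorphic. Then for all basepoints $x_0\in M_0$ and $y_0\in N_0$: $\mathcal{S}_{\mathcal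 P}$ is virtually nilpotent with respect to $x_0$ if and only if $\mathcal{S}_{\mathcal Q}$ is virtually nilpotent with respect to $y_0$; and $\mathcal{S}_{\mathcal P}$ is virtually abelian with respect to $x_0$ if and only if $\mathcal{S}_{\mathcal Q}$ is virtually abelian with respect to $y_0$. -/

import Mathlib

universe u v

open Topology

/-- The base change of a covering map along a continuous map is a covering map. -/
theorem isCoveringMap_pullback_fst {B B' E : Type u} [TopologicalSpace B] [TopologicalSpace B']
    [TopologicalSpace E] (f : C(B', B)) {q : E → B} (hq : IsCoveringMap q) :
    IsCoveringMap (fun z : Function.Pullback f q => z.1.1) := by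
  intro b
  obtain ⟨hI, U, hbU, hU, -, H, hH⟩ := hq (f b)
  have hev : IsEvenlyCovered (fun z : Function.Pullback f q => z.1.1) b (q ⁻¹' {f b}) := by
    refine ⟨hI, f ⁻¹' U, hbU, hU.preimage f.continuous,
      (hU.preimage f.continuous).preimage (continuous_fst.comp continuous_subtype_val),
      { toFun := fun z => (⟨z.1.1.1, z.2⟩,
          (H ⟨z.1.1.2, by
            have h1 : f z.1.1.1 = q z.1.1.2 := z.1.2
            have h2 : f z.1.1.1 ∈ U := z.2
            rw [h1] at h2
            exact h2⟩).2)
        invFun := fun y => ⟨⟨(y.1.1, (H.symm (⟨f y.1.1, y.1.2⟩, y.2)).1), by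
            simp [← hH]⟩, y.1.2⟩
        left_inv := ?_
        right_inv := ?_
        continuous_toFun := by fun_prop
        continuous_invFun := by fun_prop }, fun _ => rfl⟩
    · rintro ⟨⟨⟨b', e⟩, h⟩, hb'⟩
      apply Subtype.ext
      apply Subtype.ext
      refine Prod.ext rfl ?_
      have he : e ∈ q ⁻¹' U := by
        have h2 : f b' ∈ U := hb'
        have h1 : f b' = q e := h
        rw [h1] at h2
        exact h2
      have key : H.symm (⟨f b', hb'⟩, (H ⟨e, he⟩).2) = ⟨e, he⟩ := by
        rw [Homeomorph.symm_apply_eq]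
        refine Prod.ext (Subtype.ext ?_) rfl
        rw [hH]
        exact h
      exact congrArg Subtype.val key
    · rintro ⟨⟨b', hb'⟩, i⟩
      refine Prod.ext rfl ?_
      simp
  exact hev.to_isEvenlyCovered_preimage

/-- A tower of covering spaces of a fixed space `B`: covering maps `q ℓ : E ℓ → B` together with
bonding maps `p ℓ : E (ℓ + 1) → E ℓ` over `B`. -/
structure CoveringTower (B : Type u) [TopologicalSpace B] where
  E : ℕ → Type u
  [topE : ∀ ℓ, TopologicalSpace (E ℓ)]
  p : ∀ ℓ, E (ℓ + 1) → E ℓ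
  continuous_p : ∀ ℓ, Continuous (p ℓ)
  q : ∀ ℓ, E ℓ → B
  isCoveringMap_q : ∀ ℓ, IsCoveringMap (q ℓ)
  q_comp_p : ∀ ℓ, q ℓ ∘ p ℓ = q (ℓ + 1)

attribute [instance] CoveringTower.topE

namespace CoveringTower

variable {B : Type u} [TopologicalSpace B] (S : CoveringTower B)

/-- The inverse limit of the tower, with the topology induced from the product topology. -/
abbrev Limit : Type u := {x : ∀ ℓ, S.E ℓ // ∀ ℓ, S.p ℓ (x (ℓ + 1)) = x ℓ}

/-- The projection of the inverse limit onto the base. -/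
def proj (x : S.Limit) : B := S.q 0 (x.1 0)

theorem q_apply (x : S.Limit) (ℓ : ℕ) : S.q ℓ (x.1 ℓ) = S.proj x := by
  induction ℓ with
  | zero => rfl
  | succ k ih =>
    rw [← ih, ← congrFun (S.q_comp_p k) (x.1 (k + 1)), Function.comp_apply, x.2 k]

/-- The fiber of the inverse limit over a point of the base. -/
abbrev Fiber (b : B) : Type u := S.proj ⁻¹' {b}

/-- The coordinates of a point in the fiber over `b`: a point of each fiber of `q ℓ` over `b`. -/
def coord {b : B} (x : S.Fiber b) (ℓ : ℕ) : S.q ℓ ⁻¹' {b} :=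
  ⟨x.1.1 ℓ, (S.q_apply x.1 ℓ).trans x.2⟩

/-- Monodromies of successive levels are compatible with the bonding maps. -/
theorem p_monodromy {b : B} (γ : FundamentalGroup B b) (ℓ : ℕ) (e : S.q (ℓ + 1) ⁻¹' {b})
    (e' : S.q ℓ ⁻¹' {b}) (h : S.p ℓ e.1 = e'.1) :
    S.p ℓ ((S.isCoveringMap_q (ℓ + 1)).monodromyPerm b γ e).1 =
      ((S.isCoveringMap_q ℓ).monodromyPerm b γ e').1 := by
  obtain ⟨γ⟩ := γ
  obtain ⟨e', he'⟩ := e'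
  subst h
  have hq : ∀ y, S.q ℓ (S.p ℓ y) = S.q (ℓ + 1) y := congrFun (S.q_comp_p ℓ)
  have h0 : γ 0 = S.q (ℓ + 1) e.1 := γ.source.trans e.2.symm
  have h0' : γ 0 = S.q ℓ (S.p ℓ e.1) := h0.trans (hq _).symm
  have key := ((S.isCoveringMap_q ℓ).eq_liftPath_iff (γ := (γ : C(unitInterval, B)))
    (e := S.p ℓ e.1) (γ_0 := h0')
    (Γ := S.p ℓ ∘ (S.isCoveringMap_q (ℓ + 1)).liftPath γ e.1 h0)).2
    ⟨(S.continuous_p ℓ).comp (ContinuousMap.continuous _), by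
      rw [← Function.comp_assoc, S.q_comp_p ℓ]
      exact (S.isCoveringMap_q (ℓ + 1)).liftPath_lifts _ _ h0, by
      simp [(S.isCoveringMap_q (ℓ + 1)).liftPath_zero]⟩
  exact congrFun key 1

/-- The transformation of the fiber over `b` given by the monodromy of `γ` on every level. -/
noncomputable def transport {b : B} (γ : FundamentalGroup B b) (x : S.Fiber b) : S.Fiber b :=
  ⟨⟨fun ℓ => ((S.isCoveringMap_q ℓ).monodromyPerm b γ (S.coord x ℓ)).1,
    fun ℓ => S.p_monodromy γ ℓ _ _ (x.1.2 ℓ)⟩,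
    ((S.isCoveringMap_q 0).monodromyPerm b γ (S.coord x 0)).2⟩

theorem coord_transport {b : B} (γ : FundamentalGroup B b) (x : S.Fiber b) (ℓ : ℕ) :
    S.coord (S.transport γ x) ℓ = (S.isCoveringMap_q ℓ).monodromyPerm b γ (S.coord x ℓ) := rfl

theorem coord_ext {b : B} {x y : S.Fiber b} (h : ∀ ℓ, S.coord x ℓ = S.coord y ℓ) : x = y :=
  Subtype.ext (Subtype.ext (funext fun ℓ => congrArg Subtype.val (h ℓ)))

theorem transport_one {b : B} (x : S.Fiber b) : S.transport 1 x = x :=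
  S.coord_ext fun ℓ => by rw [coord_transport, map_one]; rfl

theorem transport_mul {b : B} (γ δ : FundamentalGroup B b) (x : S.Fiber b) :
    S.transport (γ * δ) x = S.transport γ (S.transport δ x) :=
  S.coord_ext fun ℓ => by rw [coord_transport, map_mul]; rfl

theorem continuous_coord {b : B} (ℓ : ℕ) : Continuous fun x : S.Fiber b => S.coord x ℓ :=
  Continuous.subtype_mk
    ((continuous_apply ℓ).comp (continuous_subtype_val.comp continuous_subtype_val)) _

theorem continuous_transport {b : B} (γ : FundamentalGroup B b) :
    Continuous (S.transport γ) := by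
  refine Continuous.subtype_mk (Continuous.subtype_mk (continuous_pi fun ℓ => ?_) _) _
  have : DiscreteTopology (S.q ℓ ⁻¹' {b}) := (S.isCoveringMap_q ℓ b).1
  exact continuous_subtype_val.comp (continuous_of_discreteTopology.comp (S.continuous_coord ℓ))

/-- The monodromy action of `π₁(B, b)` on the fiber of the inverse limit over `b`, as a
homomorphism into the group of homeomorphisms of the fiber. -/
noncomputable def monodromy (b : B) : FundamentalGroup B b →* (S.Fiber b ≃ₜ S.Fiber b) where
  toFun γ :=
    { toFun := S.transport γ
      invFun := S.transport γ⁻¹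
      left_inv := fun x => by rw [← transport_mul, inv_mul_cancel, transport_one]
      right_inv := fun x => by rw [← transport_mul, mul_inv_cancel, transport_one]
      continuous_toFun := S.continuous_transport γ
      continuous_invFun := S.continuous_transport γ⁻¹ }
  map_one' := Homeomorph.ext fun x => S.transport_one x
  map_mul' γ δ := Homeomorph.ext fun x => S.transport_mul γ δ x

/-- The image of the monodromy action at `b` is a nilpotent group. -/
def IsNilpotent (b : B) : Prop := Group.IsNilpotent (S.monodromy b).range

/-- The image of the monodromy action at `b` is an abelian group. -/
def IsAbelian (b : B) : Prop := ∀ g ∈ (S.monodromy b).range, ∀ h ∈ (S.monodromy b).range,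
  g * h = h * g

variable {B' : Type u} [TopologicalSpace B']

/-- The pull-back of a tower along `f : B' → B`, level by level. -/
def pullback (f : C(B', B)) : CoveringTower B' where
  E ℓ := Function.Pullback f (S.q ℓ)
  p ℓ z := ⟨(z.1.1, S.p ℓ z.1.2), z.2.trans (congrFun (S.q_comp_p ℓ) z.1.2).symm⟩
  continuous_p ℓ := by
    have := S.continuous_p ℓ
    fun_prop
  q ℓ z := z.1.1
  isCoveringMap_q ℓ := isCoveringMap_pullback_fst f (S.isCoveringMap_q ℓ)
  q_comp_p _ := rfl

/-- The first coordinates of a point of the limit of the pulled-back tower all agree. -/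
theorem pullback_fst (f : C(B', B)) (x : (S.pullback f).Limit) (ℓ : ℕ) :
    (x.1 ℓ).1.1 = (x.1 0).1.1 := (S.pullback f).q_apply x ℓ

/-- The inverse limit of the pulled-back tower is the pull-back of the inverse limit. -/
def pullbackHomeomorph (f : C(B', B)) :
    (S.pullback f).Limit ≃ₜ Function.Pullback f S.proj where
  toFun x := ⟨((S.pullback f).proj x,
    ⟨fun ℓ => (x.1 ℓ).1.2, fun ℓ => congrArg (fun z => z.1.2) (x.2 ℓ)⟩), (x.1 0).2⟩
  invFun z := ⟨fun ℓ => ⟨(z.1.1, z.1.2.1 ℓ), z.2.trans (S.q_apply z.1.2 ℓ).symm⟩,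
    fun ℓ => Subtype.ext (Prod.ext rfl (z.1.2.2 ℓ))⟩
  left_inv x := Subtype.ext (funext fun ℓ => Subtype.ext
    (Prod.ext (S.pullback_fst f x ℓ).symm rfl))
  right_inv _ := rfl
  continuous_toFun := by
    have h : ∀ ℓ, Continuous fun x : (S.pullback f).Limit => x.1 ℓ := fun ℓ =>
      (continuous_apply ℓ).comp continuous_subtype_val
    refine Continuous.subtype_mk (Continuous.prodMk ?_ (Continuous.subtype_mk ?_ _)) _
    · exact continuous_fst.comp (continuous_subtype_val.comp (h 0))
    · exact continuous_pi fun ℓ => continuous_snd.comp (continuous_subtype_val.comp (h ℓ))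
  continuous_invFun := by
    refine Continuous.subtype_mk (continuous_pi fun ℓ => Continuous.subtype_mk
      (Continuous.prodMk (continuous_fst.comp continuous_subtype_val) ?_) _) _
    exact (continuous_apply ℓ).comp
      (continuous_subtype_val.comp (continuous_snd.comp continuous_subtype_val))

end CoveringTower

/-- A pointed connected covering space of `(B, b)` associated to the subgroup `H` of `π₁(B, b)`:
the projection maps the fundamental group of the covering space onto `H`. -/
structure AssociatedCover {B : Type u} [TopologicalSpace B] (b : B)
    (H : Subgroup (FundamentalGroup B b)) where
  Carrier : Type u
  [top : TopologicalSpace Carrier]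
  [connected : ConnectedSpace Carrier]
  proj : C(Carrier, B)
  isCoveringMap_proj : IsCoveringMap proj
  basepoint : Carrier
  proj_basepoint : proj basepoint = b
  range_eq : (FundamentalGroup.mapOfEq proj proj_basepoint).range = H

attribute [instance] AssociatedCover.top AssociatedCover.connected

/-- A presentation of a weak solenoid: a sequence of connected compact (Hausdorff) manifolds
without boundary, of the same dimension, and covering maps `p ℓ : M (ℓ + 1) → M ℓ` of finite
degree greater than one. (Such maps are automatically proper and surjective.) -/
structure WeakSolenoidPresentation where
  dim : ℕ
  M : ℕ → Type u
  [topM : ∀ ℓ, TopologicalSpace (M ℓ)]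
  [t2M : ∀ ℓ, T2Space (M ℓ)]
  [compactM : ∀ ℓ, CompactSpace (M ℓ)]
  [connectedM : ∀ ℓ, ConnectedSpace (M ℓ)]
  [chartedM : ∀ ℓ, ChartedSpace (EuclideanSpace ℝ (Fin dim)) (M ℓ)]
  p : ∀ ℓ, M (ℓ + 1) → M ℓ
  isCoveringMap_p : ∀ ℓ, IsCoveringMap (p ℓ)
  degree : ℕ → ℕ
  one_lt_degree : ∀ ℓ, 1 < degree ℓ
  card_fiber : ∀ ℓ (y : M ℓ), Nat.card (p ℓ ⁻¹' {y}) = degree ℓ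

attribute [instance] WeakSolenoidPresentation.topM WeakSolenoidPresentation.t2M
  WeakSolenoidPresentation.compactM WeakSolenoidPresentation.connectedM
  WeakSolenoidPresentation.chartedM

namespace WeakSolenoidPresentation

variable (P : WeakSolenoidPresentation.{u})

/-- The composition `M ℓ → M 0` of the bonding maps. -/
def q : ∀ ℓ, P.M ℓ → P.M 0
  | 0 => id
  | ℓ + 1 => q ℓ ∘ P.p ℓ

theorem isCoveringMap_q (ℓ : ℕ) : IsCoveringMap (P.q ℓ) := by
  rw [← isLocalHomeomorph_iff_isCoveringMap]
  induction ℓ with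
  | zero => exact (Homeomorph.refl (P.M 0)).isLocalHomeomorph
  | succ k ih => exact ih.comp (P.isCoveringMap_p k).isLocalHomeomorph

/-- The covering spaces `M ℓ` of the base `M 0`. -/
def tower : CoveringTower (P.M 0) where
  E := P.M
  p := P.p
  continuous_p ℓ := (P.isCoveringMap_p ℓ).continuous
  q := P.q
  isCoveringMap_q := P.isCoveringMap_q
  q_comp_p _ := rfl

/-- The weak solenoid defined by the presentation: the inverse limit of the bonding maps. -/
abbrev Solenoid : Type u := P.tower.Limit

/-- There is a finite-index subgroup `H` of `π₁(M 0, x₀)` such that the pull-back of the solenoid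
to the finite covering of `M 0` associated to `H` is nilpotent. -/
def IsVirtuallyNilpotent (x₀ : P.M 0) : Prop :=
  ∃ H : Subgroup (FundamentalGroup (P.M 0) x₀), H.FiniteIndex ∧
    ∃ c : AssociatedCover x₀ H, (P.tower.pullback c.proj).IsNilpotent c.basepoint

/-- There is a finite-index subgroup `H` of `π₁(M 0, x₀)` such that the pull-back of the solenoid
to the finite covering of `M 0` associated to `H` is abelian. -/
def IsVirtuallyAbelian (x₀ : P.M 0) : Prop :=
  ∃ H : Subgroup (FundamentalGroup (P.M 0) x₀), H.FiniteIndex ∧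
    ∃ c : AssociatedCover x₀ H, (P.tower.pullback c.proj).IsAbelian c.basepoint

end WeakSolenoidPresentation

/-! Both properties reduce to one statement about monodromy, `HasVirtualClassLE`: some finite-index
subgroup `H` of the fundamental group has its `n`-th lower central term acting trivially on the
fiber of the limit. "Some `n`" is virtual nilpotency and `n = 1` is virtual abelianness, so it
suffices to transfer this for each `n`.

The geometric core is `exists_intertwining`. In a fiber of the second limit, take the points `T`
sharing the level-`k` coordinate of a point `s`. For large `k` the homeomorphism carries `T` close
to one point of the first limit; sliding along short paths and then one fixed path gives an
injection `φ` of `T` into a fiber. A loop fixing that coordinate lifts to paths from all points of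
`T`; transported to the first limit, their projections are pointwise close to a single path, so one
loop there induces the same motion of `φ(T)`. This loop is only chosen, with no homomorphism;
`exists_finiteIndex_lowerCentralSeries_smul_eq` therefore works with the subgroup of matching pairs.

The definitions also ask for a covering realizing the subgroup. By `HasVirtualClassLE.exists_level`,
`H` may be replaced by the kernel of the monodromy on one level, and `exists_associatedCover_le_ker`
constructs a covering for a finite-index subgroup of that kernel. -/

/-! ### Group theory: lower central series and finite-index subgroups. -/

/-- Let `φ : Y → X` be injective on `T ⊆ Y` and let `D` be a finite-index subgroup preserving `T`
every element of which is intertwined by `φ` with some element of `G`. If a finite-index subgroup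
of `G` acts on `X` through a nilpotent group of class at most `n`, and every orbit of `Γ` meets
`T`, then a finite-index subgroup of `Γ` acts on `Y` through a group of class at most `n`. -/
theorem exists_finiteIndex_lowerCentralSeries_smul_eq {Γ G Y X : Type*} [Group Γ] [Group G]
    [MulAction Γ Y] [MulAction G X] (D : Subgroup Γ) (hD : D.FiniteIndex) (T : Set Y)
    (hT : ∀ g ∈ D, ∀ t ∈ T, g • t ∈ T) (φ : Y → X) (hφ : Set.InjOn φ T)
    (h : ∀ g ∈ D, ∃ γ : G, ∀ t ∈ T, φ (g • t) = γ • φ t) (H : Subgroup G) (hH : H.FiniteIndex)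
    (n : ℕ) (hn : ∀ γ ∈ H.lowerCentralSeries n, ∀ x : X, γ • x = x)
    (htrans : ∀ y : Y, ∃ g : Γ, g • y ∈ T) :
    ∃ H' : Subgroup Γ, H'.FiniteIndex ∧ ∀ g ∈ H'.lowerCentralSeries n, ∀ y : Y, g • y = y := by
  -- Matching pairs form a group although the choice of partner need not be multiplicative. Lower
  -- central series commute with both projections, which carries triviality from `H` to the first
  -- factor.
  let K : Subgroup (Γ × G) :=
    { carrier := {z | z.1 ∈ D ∧ z.2 ∈ H ∧ ∀ t ∈ T, φ (z.1 • t) = z.2 • φ t}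
      one_mem' := ⟨D.one_mem, H.one_mem, fun t _ => by simp⟩
      mul_mem' := fun {a b} ha hb => ⟨D.mul_mem ha.1 hb.1, H.mul_mem ha.2.1 hb.2.1, fun t ht => by
        rw [Prod.fst_mul, Prod.snd_mul, mul_smul, mul_smul, ha.2.2 _ (hT _ hb.1 t ht),
          hb.2.2 t ht]⟩
      inv_mem' := fun {a} ha => ⟨D.inv_mem ha.1, H.inv_mem ha.2.1, fun t ht => by
        rw [Prod.fst_inv, Prod.snd_inv, eq_inv_smul_iff,
          ← ha.2.2 _ (hT _ (D.inv_mem ha.1) t ht), smul_inv_smul]⟩ }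
  have hKD : K.map (MonoidHom.fst Γ G) ≤ D := by
    rintro _ ⟨z, hz, rfl⟩
    exact hz.1
  have hKtriv : ∀ g ∈ (K.map (MonoidHom.fst Γ G)).lowerCentralSeries n, ∀ t ∈ T, g • t = t := by
    intro g hg t ht
    rw [← Subgroup.map_lowerCentralSeries] at hg
    obtain ⟨z, hz, rfl⟩ := hg
    have hzK : z ∈ K := Subgroup.lowerCentralSeries_le_self K n hz
    have hz2 : z.2 ∈ H.lowerCentralSeries n := by
      have h1 : z.2 ∈ (K.lowerCentralSeries n).map (MonoidHom.snd Γ G) := ⟨z, hz, rfl⟩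
      rw [Subgroup.map_lowerCentralSeries] at h1
      refine Subgroup.lowerCentralSeries_mono n ?_ h1
      rintro _ ⟨w, hw, rfl⟩
      exact hw.2.1
    exact hφ (hT _ hzK.1 t ht) ht ((hzK.2.2 t ht).trans (hn _ hz2 _))
  have hfin : (K.map (MonoidHom.fst Γ G)).FiniteIndex := by
    choose! c hc using h
    -- If the chosen partners of two elements of `D` lie in one coset of `H`, their quotient pair
    -- belongs to `K`; hence there are at most as many cosets as in `G ⧸ H`.
    have hinj : Function.Injective
        (fun x : D ⧸ (K.map (MonoidHom.fst Γ G)).subgroupOf D => (c x.out.1 : G ⧸ H)) := by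
      intro x y hxy
      rw [← QuotientGroup.out_eq' x, ← QuotientGroup.out_eq' y, QuotientGroup.eq]
      have h1 : (c x.out.1)⁻¹ * c y.out.1 ∈ H := QuotientGroup.eq.1 hxy
      refine ⟨(x.out.1⁻¹ * y.out.1, (c x.out.1)⁻¹ * c y.out.1),
        ⟨D.mul_mem (D.inv_mem x.out.2) y.out.2, h1, fun t ht => ?_⟩, rfl⟩
      have hyt := hT _ y.out.2 t ht
      rw [mul_smul, mul_smul, eq_inv_smul_iff, ← hc _ y.out.2 t ht,
        ← hc _ x.out.2 _ (hT _ (D.inv_mem x.out.2) _ hyt), smul_inv_smul]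
    have : Finite (G ⧸ H) := Subgroup.finite_quotient_of_finiteIndex
    have hf : Finite (D ⧸ (K.map (MonoidHom.fst Γ G)).subgroupOf D) := Finite.of_injective _ hinj
    have h2 : (K.map (MonoidHom.fst Γ G)).relIndex D ≠ 0 :=
      (Subgroup.finiteIndex_of_finite_quotient
        (H := (K.map (MonoidHom.fst Γ G)).subgroupOf D)).index_ne_zero
    refine ⟨?_⟩
    rw [← Subgroup.relIndex_mul_index hKD]
    exact mul_ne_zero h2 hD.index_ne_zero
  -- Triviality is known only on `T`. Normality allows conjugating by an element that moves `y` into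
  -- `T`.
  refine ⟨(K.map (MonoidHom.fst Γ G)).normalCore, inferInstance, fun g hg y => ?_⟩
  obtain ⟨a, ha⟩ := htrans y
  have h1 := hKtriv _ (Subgroup.lowerCentralSeries_mono n (Subgroup.normalCore_le _)
    ((Subgroup.lowerCentralSeries_normal _ n).conj_mem g hg a)) _ ha
  rw [mul_smul, mul_smul, inv_smul_smul] at h1
  exact MulAction.injective a h1

/-- A descending sequence of subgroups stabilizes modulo a subgroup of finite index. -/
theorem exists_le_sup_of_antitone {G : Type*} [Group G] (H : Subgroup G) (hH : H.FiniteIndex)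
    (D : ℕ → Subgroup G) (hD : Antitone D) : ∃ k, ∀ m, D k ≤ H ⊔ D m := by
  have hfi : ∀ m, (H ⊔ D m).FiniteIndex := fun m => Subgroup.finiteIndex_of_le le_sup_left
  have hanti : Antitone fun m => H ⊔ D m := fun a b hab => sup_le_sup_left (hD hab) H
  have hle : ∀ m, (H ⊔ D m).index ≤ H.index := fun m =>
    Nat.le_of_dvd (Nat.pos_of_ne_zero hH.index_ne_zero) (Subgroup.index_dvd_of_le le_sup_left)
  -- The indices are bounded by that of `H`; from a level of maximal index on, the nested groups `H
  -- ⊔ D m` are equal.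
  obtain ⟨k, hk⟩ : ∃ k, ∀ m, (H ⊔ D m).index ≤ (H ⊔ D k).index := by
    have hne : (Set.range fun m => (H ⊔ D m).index).Nonempty := ⟨_, 0, rfl⟩
    have hb : BddAbove (Set.range fun m => (H ⊔ D m).index) :=
      ⟨H.index, by rintro _ ⟨m, rfl⟩; exact hle m⟩
    obtain ⟨k, hk⟩ := Nat.sSup_mem hne hb
    exact ⟨k, fun m => (le_csSup hb ⟨m, rfl⟩).trans hk.ge⟩
  refine ⟨k, fun m => ?_⟩
  have h1 : H ⊔ D (max k m) ≤ H ⊔ D k := hanti (le_max_left k m)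
  have h2 : (H ⊔ D (max k m)).index = (H ⊔ D k).index :=
    le_antisymm (hk _) (Nat.le_of_dvd (Nat.pos_of_ne_zero (hfi _).index_ne_zero)
      (Subgroup.index_dvd_of_le h1))
  have h3 : H ⊔ D k ≤ H ⊔ D (max k m) := by
    rw [← Subgroup.relIndex_eq_one]
    have h4 := Subgroup.relIndex_mul_index h1
    rw [h2] at h4
    exact Nat.eq_of_mul_eq_mul_right (Nat.pos_of_ne_zero (hfi k).index_ne_zero) (by simpa using h4)
  exact le_sup_right.trans (h3.trans (hanti (le_max_right k m)))

/-! ### Lifting paths and homotopies to the limit. -/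

/-- Any two paths in `W` with the same endpoints are homotopic in the ambient space. -/
def PathHomotopyTrivial {B : Type*} [TopologicalSpace B] (W : Set B) : Prop :=
  ∀ ⦃x y : B⦄ (p p' : Path x y), (∀ t, p t ∈ W) → (∀ t, p' t ∈ W) → p.Homotopic p'

theorem PathHomotopyTrivial.mono {B : Type*} [TopologicalSpace B] {W W' : Set B}
    (h : PathHomotopyTrivial W) (hW : W' ⊆ W) : PathHomotopyTrivial W' :=
  fun _ _ p p' hp hp' => h p p' (fun t => hW (hp t)) (fun t => hW (hp' t))

theorem JoinedIn.image_of_continuous {X Y : Type*} [TopologicalSpace X] [TopologicalSpace Y]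
    {A : Set X} {x y : X} (h : JoinedIn A x y) {f : X → Y} (hf : Continuous f) {A' : Set Y}
    (hA : Set.MapsTo f A A') : JoinedIn A' (f x) (f y) := by
  obtain ⟨p, hp⟩ := h
  exact ⟨p.map hf, fun t => hA (hp t)⟩

namespace CoveringTower

variable {B : Type u} [TopologicalSpace B] (S : CoveringTower B)

theorem continuous_eval (ℓ : ℕ) : Continuous fun x : S.Limit => x.1 ℓ :=
  (continuous_apply ℓ).comp continuous_subtype_val

theorem continuous_proj : Continuous S.proj :=
  (S.isCoveringMap_q 0).continuous.comp (S.continuous_eval 0)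

/-- The point `y` of the limit is the endpoint of a lift of the path `c` starting at `x`. -/
def Lifts {b b' : B} (c : Path b b') (x y : S.Limit) : Prop :=
  ∃ p : Path x y, ∀ t, S.proj (p t) = c t

variable {S}

theorem Lifts.trans {b b' b'' : B} {c : Path b b'} {c' : Path b' b''} {x y z : S.Limit}
    (h : S.Lifts c x y) (h' : S.Lifts c' y z) : S.Lifts (c.trans c') x z := by
  obtain ⟨p, hp⟩ := h
  obtain ⟨p', hp'⟩ := h'
  refine ⟨p.trans p', fun t => ?_⟩
  simp only [Path.trans_apply]
  split_ifs
  · exact hp _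
  · exact hp' _

theorem Lifts.symm {b b' : B} {c : Path b b'} {x y : S.Limit} (h : S.Lifts c x y) :
    S.Lifts c.symm y x := by
  obtain ⟨p, hp⟩ := h
  exact ⟨p.symm, fun t => hp _⟩

theorem Lifts.target {b b' : B} {c : Path b b'} {x y : S.Limit} (h : S.Lifts c x y) :
    S.proj y = b' := by
  obtain ⟨p, hp⟩ := h
  simpa using hp 1

theorem Lifts.joinedIn {b b' : B} {c : Path b b'} {x y : S.Limit} (h : S.Lifts c x y) {A : Set B}
    (hA : ∀ t, c t ∈ A) : JoinedIn (S.proj ⁻¹' A) x y := by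
  obtain ⟨p, hp⟩ := h
  exact ⟨p, fun t => by rw [Set.mem_preimage, hp]; exact hA t⟩

/-- Lifts of homotopic paths starting at points with the same coordinate have the same coordinate
at the end. -/
theorem eval_eq_of_homotopic {b b' : B} {c c' : Path b b'} (hc : c.Homotopic c')
    {x y x' y' : S.Limit} {p : Path x y} {p' : Path x' y'} (hp : ∀ t, S.proj (p t) = c t)
    (hp' : ∀ t, S.proj (p' t) = c' t) {ℓ : ℕ} (h : x.1 ℓ = x'.1 ℓ) : y.1 ℓ = y'.1 ℓ := by
  have hcov := S.isCoveringMap_q ℓ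
  have h0 : c 0 = S.q ℓ (x.1 ℓ) := by rw [S.q_apply, ← hp 0, p.source]
  have h0' : c' 0 = S.q ℓ (x.1 ℓ) := by rw [h, S.q_apply, ← hp' 0, p'.source]
  have key := hcov.liftPath_apply_one_eq_of_homotopicRel hc (x.1 ℓ) h0 h0'
  have e1 : (fun t => (p t).1 ℓ) = hcov.liftPath c (x.1 ℓ) h0 :=
    (hcov.eq_liftPath_iff _).2 ⟨(S.continuous_eval ℓ).comp p.continuous,
      funext fun t => (S.q_apply _ _).trans (hp t), by simp⟩
  have e2 : (fun t => (p' t).1 ℓ) = hcov.liftPath c' (x.1 ℓ) h0' :=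
    (hcov.eq_liftPath_iff _).2 ⟨(S.continuous_eval ℓ).comp p'.continuous,
      funext fun t => (S.q_apply _ _).trans (hp' t), by simp [h]⟩
  have := (congrFun e1 1).trans (key.trans (congrFun e2 1).symm)
  simpa using this

/-- Two lifts of a path agree in a coordinate as soon as they do so at the beginning. -/
theorem eval_eq_of_lifts {b b' : B} {c : Path b b'} {x y x' y' : S.Limit} {p : Path x y}
    {p' : Path x' y'} (hp : ∀ t, S.proj (p t) = c t) (hp' : ∀ t, S.proj (p' t) = c t) {ℓ : ℕ}
    (h : x.1 ℓ = x'.1 ℓ) (t : unitInterval) : (p t).1 ℓ = (p' t).1 ℓ := by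
  refine congrFun ((S.isCoveringMap_q ℓ).eq_of_comp_eq (g₁ := fun t => (p t).1 ℓ)
    (g₂ := fun t => (p' t).1 ℓ) ((S.continuous_eval ℓ).comp p.continuous)
    ((S.continuous_eval ℓ).comp p'.continuous) (funext fun t => ?_) 0 (by simpa using h)) t
  exact (S.q_apply _ _).trans ((hp t).trans ((hp' t).symm.trans (S.q_apply _ _).symm))

theorem Lifts.right_unique {b b' : B} {c : Path b b'} {x y y' : S.Limit} (h : S.Lifts c x y)
    (h' : S.Lifts c x y') : y = y' := by
  obtain ⟨p, hp⟩ := h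
  obtain ⟨p', hp'⟩ := h'
  exact Subtype.ext (funext fun ℓ => eval_eq_of_homotopic (.refl c) hp hp' rfl)

theorem Lifts.left_unique {b b' : B} {c : Path b b'} {x x' y : S.Limit} (h : S.Lifts c x y)
    (h' : S.Lifts c x' y) : x = x' :=
  h.symm.right_unique h'.symm

variable (S)

/-- Uniqueness of lifts makes the levelwise lifts compatible, so path lifting survives in the limit
even though `S.proj` need not be a covering map. -/
theorem exists_lifts {b b' : B} (c : Path b b') {x : S.Limit} (hx : S.proj x = b) :
    ∃ y, S.Lifts c x y := by
  have h0 : ∀ ℓ, c 0 = S.q ℓ (x.1 ℓ) := fun ℓ => by rw [S.q_apply, hx, c.source]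
  let Γ : ∀ ℓ, C(unitInterval, S.E ℓ) := fun ℓ => (S.isCoveringMap_q ℓ).liftPath c (x.1 ℓ) (h0 ℓ)
  have hΓ : ∀ ℓ t, S.p ℓ (Γ (ℓ + 1) t) = Γ ℓ t := fun ℓ t => by
    refine congrFun (((S.isCoveringMap_q ℓ).eq_liftPath_iff (h0 ℓ)
      (Γ := S.p ℓ ∘ Γ (ℓ + 1))).2 ⟨(S.continuous_p ℓ).comp (Γ (ℓ + 1)).continuous, ?_, ?_⟩) t
    · rw [← Function.comp_assoc, S.q_comp_p ℓ]
      exact (S.isCoveringMap_q (ℓ + 1)).liftPath_lifts _ _ _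
    · rw [Function.comp_apply, ← x.2 ℓ]
      exact congrArg _ ((S.isCoveringMap_q (ℓ + 1)).liftPath_zero _ _ _)
  refine ⟨⟨fun ℓ => Γ ℓ 1, fun ℓ => hΓ ℓ 1⟩, ⟨⟨⟨fun t => ⟨fun ℓ => Γ ℓ t, fun ℓ => hΓ ℓ t⟩, ?_⟩,
    ?_, rfl⟩, fun t => ?_⟩⟩
  · exact Continuous.subtype_mk (continuous_pi fun ℓ => (Γ ℓ).continuous) _
  · exact Subtype.ext (funext fun ℓ => (S.isCoveringMap_q ℓ).liftPath_zero _ _ _)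
  · exact congrFun ((S.isCoveringMap_q 0).liftPath_lifts _ _ (h0 0)) t

theorem lifts_transport {b : B} (c : Path b b) (x : S.Fiber b) :
    S.Lifts c x.1 (S.transport (.mk c) x).1 := by
  obtain ⟨y, p, hp⟩ := S.exists_lifts c x.2
  have hxy : (S.transport (.mk c) x).1 = y := by
    refine Subtype.ext (funext fun ℓ => ?_)
    have h0 : c 0 = S.q ℓ (x.1.1 ℓ) := by rw [S.q_apply, ← hp 0, p.source]
    have e1 : (fun t => (p t).1 ℓ) = (S.isCoveringMap_q ℓ).liftPath c (x.1.1 ℓ) h0 :=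
      ((S.isCoveringMap_q ℓ).eq_liftPath_iff _).2 ⟨(S.continuous_eval ℓ).comp p.continuous,
        funext fun t => (S.q_apply _ _).trans (hp t), by simp⟩
    exact (congrFun e1 1).symm.trans (by simp)
  rw [hxy]
  exact ⟨p, hp⟩

theorem transport_eq_of_lifts {b : B} {c : Path b b} {x y : S.Fiber b} (h : S.Lifts c x.1 y.1) :
    S.transport (.mk c) x = y :=
  Subtype.ext ((S.lifts_transport c x).right_unique h)

theorem exists_joinedIn {A : Set B} {x : S.Limit} {b' : B} (h : JoinedIn A (S.proj x) b') :
    ∃ y, S.proj y = b' ∧ JoinedIn (S.proj ⁻¹' A) x y := by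
  obtain ⟨c, hc⟩ := h
  obtain ⟨y, hy⟩ := S.exists_lifts c rfl
  exact ⟨y, hy.target, hy.joinedIn hc⟩

variable {S}

/-- The projected path is a null-homotopic loop, so at every level its lift closes up. Thus a path
component of the preimage of `W` meets each fiber at most once. -/
theorem eq_of_joinedIn {W : Set B} (hW : PathHomotopyTrivial W) {x y : S.Limit}
    (h : JoinedIn (S.proj ⁻¹' W) x y) (hxy : S.proj x = S.proj y) : x = y := by
  obtain ⟨p, hp⟩ := h
  have hhom : (Path.refl (S.proj x)).Homotopic ((p.map S.continuous_proj).cast rfl hxy) :=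
    hW _ _ (fun t => by simpa using hp 0) (fun t => by simpa using hp t)
  exact Subtype.ext (funext fun ℓ => eval_eq_of_homotopic (p := Path.refl x) (p' := p) hhom
    (fun t => rfl) (fun t => rfl) rfl)

/-- Let `𝒱` be a family of path-connected open sets in which the union of two intersecting members
is path-homotopically trivial. If two paths in the limit project to paths which are pointwise
`𝒱`-close and their sources are joined in the preimage of a member of `𝒱`, so are their targets. -/
theorem joinedIn_target_of_close {𝒱 : Set (Set B)} (hopen : ∀ V ∈ 𝒱, IsOpen V)
    (hconn : ∀ V ∈ 𝒱, IsPathConnected V)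
    (htriv : ∀ V ∈ 𝒱, ∀ V' ∈ 𝒱, (V ∩ V').Nonempty → PathHomotopyTrivial (V ∪ V'))
    {x y x' y' : S.Limit} (p : Path x y) (p' : Path x' y')
    (hclose : ∀ t, ∃ V ∈ 𝒱, S.proj (p t) ∈ V ∧ S.proj (p' t) ∈ V)
    (h0 : ∃ V ∈ 𝒱, JoinedIn (S.proj ⁻¹' V) x x') :
    ∃ V ∈ 𝒱, JoinedIn (S.proj ⁻¹' V) y y' := by
  let J : unitInterval → Prop := fun t => ∃ V ∈ 𝒱, JoinedIn (S.proj ⁻¹' V) (p t) (p' t)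
  -- Being joined over a member of the family is a locally constant condition in time; connectedness
  -- of the interval then carries it from 0 to 1.
  have hloc : ∀ t, ∃ N ∈ 𝓝 t, ∀ r ∈ N, ∀ r' ∈ N, J r → J r' := by
    intro t
    obtain ⟨V, hV, hp, hp'⟩ := hclose t
    have hcp : Continuous fun t => S.proj (p t) := S.continuous_proj.comp p.continuous
    have hcp' : Continuous fun t => S.proj (p' t) := S.continuous_proj.comp p'.continuous
    have hN : ((fun t => S.proj (p t)) ⁻¹' V ∩ (fun t => S.proj (p' t)) ⁻¹' V) ∈ 𝓝 t :=
      Filter.inter_mem (((hopen V hV).preimage hcp).mem_nhds hp)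
        (((hopen V hV).preimage hcp').mem_nhds hp')
    have : LocallyPathConnectedSpace unitInterval := (convex_Icc (0 : ℝ) 1).locallyPathConnectedSpace
    obtain ⟨N, ⟨hNt, hNc⟩, hN⟩ := (path_connected_basis t).mem_iff.1 hN
    refine ⟨N, hNt, fun r hr r' hr' hJ => ?_⟩
    obtain ⟨V', hV', hj⟩ := hJ
    have hrr' := hNc.joinedIn r hr r' hr'
    have j1 : JoinedIn (S.proj ⁻¹' V) (p r') (p r) :=
      (hrr'.image_of_continuous p.continuous fun a ha => (hN ha).1).symm
    have j2 : JoinedIn (S.proj ⁻¹' V) (p' r) (p' r') :=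
      hrr'.image_of_continuous p'.continuous fun a ha => (hN ha).2
    -- Slide `p r'` inside `V` to the point `z` over the projection of `p' r'`. The detour through
    -- time `r` joins `z` to `p' r'` over `V ∪ V'`, which forces equality.
    obtain ⟨z, hz, hjz⟩ := S.exists_joinedIn ((hconn V hV).joinedIn _ (hN hr').1 _ (hN hr').2)
    have hjz' : JoinedIn (S.proj ⁻¹' (V ∪ V')) z (p' r') :=
      (((hjz.symm.trans j1).mono (Set.preimage_mono Set.subset_union_left)).trans
        (hj.mono (Set.preimage_mono Set.subset_union_right))).trans
        (j2.mono (Set.preimage_mono Set.subset_union_left))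
    have hz' : z = p' r' :=
      eq_of_joinedIn (htriv V hV V' hV' ⟨S.proj (p r), (hN hr).1, hj.source_mem⟩) hjz' hz
    exact ⟨V, hV, hz' ▸ hjz⟩
  have key : J 0 → J 1 := by
    refine PreconnectedSpace.induction₂' (fun t t' => J t → J t') (fun t => ?_)
      ⟨fun a b c h1 h2 h => h2 (h1 h)⟩ 0 1
    obtain ⟨N, hN, h⟩ := hloc t
    filter_upwards [hN] with r hr
    exact ⟨h t (mem_of_mem_nhds hN) r hr, h r hr t (mem_of_mem_nhds hN)⟩
  simpa [J] using key (by simpa [J] using h0)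

end CoveringTower

/-! ### Path-trivial neighborhoods in manifolds. -/

/-- Every point has arbitrarily small path-connected open neighborhoods in which any two paths with
the same endpoints are homotopic in the ambient space. -/
def HasPathTrivialBasis (B : Type*) [TopologicalSpace B] : Prop :=
  ∀ x : B, ∀ O ∈ 𝓝 x, ∃ U ⊆ O, x ∈ U ∧ IsOpen U ∧ IsPathConnected U ∧ PathHomotopyTrivial U

theorem pathHomotopyTrivial_of_isSimplyConnected {B : Type*} [TopologicalSpace B] {W : Set B}
    (hW : IsSimplyConnected W) : PathHomotopyTrivial W := by
  intro x y p p' hp hp'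
  have := hW.simplyConnectedSpace
  have hx : x ∈ W := by simpa using hp 0
  have hy : y ∈ W := by simpa using hp 1
  let r : Path (⟨x, hx⟩ : W) ⟨y, hy⟩ := ⟨⟨fun t => ⟨p t, hp t⟩, by fun_prop⟩, by simp, by simp⟩
  let r' : Path (⟨x, hx⟩ : W) ⟨y, hy⟩ := ⟨⟨fun t => ⟨p' t, hp' t⟩, by fun_prop⟩, by simp, by simp⟩
  exact (SimplyConnectedSpace.paths_homotopic r r').map ⟨Subtype.val, continuous_subtype_val⟩

theorem ChartedSpace.hasPathTrivialBasis (E M : Type*) [NormedAddCommGroup E]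
    [InnerProductSpace ℝ E] [TopologicalSpace M] [ChartedSpace E M] : HasPathTrivialBasis M := by
  intro x O hO
  let φ := chartAt E x
  have hx : x ∈ φ.source := mem_chart_source E x
  have hN : φ.target ∩ φ.symm ⁻¹' O ∈ 𝓝 (φ x) := by
    refine Filter.inter_mem (φ.open_target.mem_nhds (φ.map_source hx)) ?_
    refine (φ.continuousAt_symm (φ.map_source hx)).preimage_mem_nhds ?_
    rwa [φ.left_inv hx]
  obtain ⟨ε, hε, hball⟩ := Metric.mem_nhds_iff.1 hN
  let ψ := (OpenPartialHomeomorph.univBall (φ x) ε).trans φ.symm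
  have hψ : ψ.source = Set.univ := by
    ext v
    simp only [ψ, OpenPartialHomeomorph.trans_source, OpenPartialHomeomorph.univBall_source,
      Set.univ_inter, Set.mem_preimage, Set.mem_univ, iff_true, OpenPartialHomeomorph.symm_source]
    refine (hball ?_).1
    rw [← OpenPartialHomeomorph.univBall_target (φ x) hε]
    exact (OpenPartialHomeomorph.univBall (φ x) ε).map_source (by simp)
  have hemb : IsOpenEmbedding ψ := ψ.isOpenEmbedding hψ
  have hsc : IsSimplyConnected (Set.range ψ) := by
    rw [← Set.image_univ, hemb.isEmbedding.isSimplyConnected_image]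
    exact (Homeomorph.Set.univ E).toHomotopyEquiv.simplyConnectedSpace
  refine ⟨Set.range ψ, ?_, ⟨0, ?_⟩, hemb.isOpen_range, hsc.isPathConnected,
    pathHomotopyTrivial_of_isSimplyConnected hsc⟩
  · rintro _ ⟨v, rfl⟩
    refine (hball ?_).2
    rw [← OpenPartialHomeomorph.univBall_target (φ x) hε]
    exact (OpenPartialHomeomorph.univBall (φ x) ε).map_source (by simp)
  · simp [ψ, φ.left_inv hx]

/-- A compact space with a basis of path-trivial open sets has such a basis in which moreover the
union of any two intersecting members is path-trivial. -/
theorem HasPathTrivialBasis.exists_fine_family {B : Type*} [TopologicalSpace B] [CompactSpace B]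
    [T2Space B] (hB : HasPathTrivialBasis B) : ∃ 𝒱 : Set (Set B),
      (∀ V ∈ 𝒱, IsOpen V) ∧ (∀ V ∈ 𝒱, IsPathConnected V) ∧
      (∀ V ∈ 𝒱, ∀ V' ∈ 𝒱, (V ∩ V').Nonempty → PathHomotopyTrivial (V ∪ V')) ∧
      ∀ x, ∀ O ∈ 𝓝 x, ∃ V ∈ 𝒱, x ∈ V ∧ V ⊆ O := by
  let _ : UniformSpace B := uniformSpaceOfCompactR1
  choose W hW hxW hWo hWc hWt using fun x : B => hB x Set.univ Filter.univ_mem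
  obtain ⟨E, hE, hEW⟩ := lebesgue_number_lemma (K := (Set.univ : Set B)) isCompact_univ hWo
    fun x _ => Set.mem_iUnion.2 ⟨x, hxW x⟩
  -- With `E` a Lebesgue entourage for the cover `W`, two `E`-small sets sharing a point `x` lie
  -- together in the `E`-neighborhood of `x`, hence in one `W i`.
  refine ⟨{V | IsOpen V ∧ IsPathConnected V ∧ V ×ˢ V ⊆ E}, fun V h => h.1, fun V h => h.2.1, ?_, ?_⟩
  · rintro V hV V' hV' ⟨x, hx, hx'⟩
    obtain ⟨i, hi⟩ := hEW x trivial
    refine (hWt i).mono (Set.Subset.trans ?_ hi)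
    rintro y (hy | hy)
    · exact hV.2.2 (Set.mk_mem_prod hx hy)
    · exact hV'.2.2 (Set.mk_mem_prod hx' hy)
  · intro x O hO
    have h1 : E ∈ 𝓝 (x, x) := nhds_le_uniformity x hE
    obtain ⟨N, N', hNo, hxN, hN'o, hxN', hsub⟩ := mem_nhds_prod_iff'.1 h1
    obtain ⟨U, hU, hxU, hUo, hUc, -⟩ := hB x (O ∩ (N ∩ N'))
      (Filter.inter_mem hO ((hNo.inter hN'o).mem_nhds ⟨hxN, hxN'⟩))
    exact ⟨U, ⟨hUo, hUc, fun z hz => hsub ⟨(hU hz.1).2.1, (hU hz.2).2.2⟩⟩, hxU,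
      fun z hz => (hU hz).1⟩

/-! ### Neighborhoods and compactness in the limit. -/

namespace CoveringTower

variable {B : Type u} [TopologicalSpace B] {S : CoveringTower B}

theorem eval_eq_of_le {x y : S.Limit} {k ℓ : ℕ} (hkl : k ≤ ℓ) (h : x.1 ℓ = y.1 ℓ) :
    x.1 k = y.1 k := by
  induction hkl with
  | refl => exact h
  | step _ ih => exact ih (by rw [← x.2, ← y.2, h])

variable (S)

/-- A basic open set constrains finitely many coordinates, and the highest of them determines the
others. -/
theorem exists_eval_preimage_subset {x : S.Limit} {O : Set S.Limit} (hO : O ∈ 𝓝 x) :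
    ∃ (ℓ : ℕ) (A : Set (S.E ℓ)), IsOpen A ∧ x.1 ℓ ∈ A ∧ ∀ y : S.Limit, y.1 ℓ ∈ A → y ∈ O := by
  have hcoord : ∀ {k ℓ : ℕ}, k ≤ ℓ → ∃ f : S.E ℓ → S.E k, Continuous f ∧
      ∀ y : S.Limit, f (y.1 ℓ) = y.1 k := by
    intro k ℓ hkl
    induction hkl with
    | refl => exact ⟨id, continuous_id, fun _ => rfl⟩
    | step _ ih =>
      obtain ⟨f, hf, hfy⟩ := ih
      exact ⟨f ∘ S.p _, hf.comp (S.continuous_p _), fun y => by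
        rw [Function.comp_apply, y.2, hfy]⟩
  obtain ⟨N, hN, hNO⟩ := mem_nhds_subtype _ _ _ |>.1 hO
  rw [nhds_pi, Filter.mem_pi'] at hN
  obtain ⟨I, t, ht, htN⟩ := hN
  have hle : ∀ i ∈ I, i ≤ I.sup id := fun i hi => Finset.le_sup (f := id) hi
  choose f hf hfy using fun i : I => hcoord (hle i.1 i.2)
  refine ⟨I.sup id, ⋂ i, f i ⁻¹' interior (t i), ?_, ?_, fun y hy => hNO (htN ?_)⟩
  · exact isOpen_iInter_of_finite fun i => isOpen_interior.preimage (hf i)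
  · refine Set.mem_iInter.2 fun i => ?_
    rw [Set.mem_preimage, hfy i]
    exact mem_interior_iff_mem_nhds.2 (ht i)
  · intro i hi
    have := Set.mem_iInter.1 hy ⟨i, hi⟩
    rw [Set.mem_preimage, hfy ⟨i, hi⟩] at this
    exact interior_subset this

/-- Every neighborhood of `x` in the limit contains a neighborhood that is saturated with respect
to lifts of paths in a neighborhood of the projection of `x`. -/
theorem exists_saturated_nhds {x : S.Limit} {O : Set S.Limit} (hO : O ∈ 𝓝 x) :
    ∃ N ∈ 𝓝 (S.proj x), ∃ O' ∈ 𝓝 x, O' ⊆ O ∧ ∀ y ∈ O', ∀ z, JoinedIn (S.proj ⁻¹' N) y z →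
      JoinedIn O' y z := by
  obtain ⟨ℓ, A, hA, hxA, hAO⟩ := S.exists_eval_preimage_subset hO
  have hcov := S.isCoveringMap_q ℓ
  obtain ⟨hI, U, hxU, hU, hqU, H, hH⟩ := hcov (S.proj x)
  have hqx : ∀ y : S.Limit, S.proj y ∈ U → y.1 ℓ ∈ S.q ℓ ⁻¹' U := fun y hy => by
    rwa [Set.mem_preimage, S.q_apply]
  let f := (H ⟨x.1 ℓ, hqx x hxU⟩).2
  let σ : U → S.E ℓ := fun b => (H.symm (b, f)).1
  have hσ : Continuous σ := by fun_prop
  have hsec : ∀ (y : S.Limit) (hy : S.proj y ∈ U), (H ⟨y.1 ℓ, hqx y hy⟩).2 = f →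
      σ ⟨S.proj y, hy⟩ = y.1 ℓ := by
    intro y hy hf
    have : H.symm (⟨S.proj y, hy⟩, f) = ⟨y.1 ℓ, hqx y hy⟩ := by
      rw [Homeomorph.symm_apply_eq]
      refine Prod.ext (Subtype.ext ?_) hf.symm
      rw [hH]
      exact (S.q_apply y ℓ).symm
    exact congrArg Subtype.val this
  have hNo : IsOpen (Subtype.val '' (σ ⁻¹' A)) := hU.isOpenMap_subtype_val _ (hA.preimage hσ)
  have hNU : Subtype.val '' (σ ⁻¹' A) ⊆ U := by
    rintro _ ⟨b, -, rfl⟩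
    exact b.2
  have hxN : S.proj x ∈ Subtype.val '' (σ ⁻¹' A) :=
    ⟨⟨S.proj x, hxU⟩, by rw [Set.mem_preimage, hsec x hxU rfl]; exact hxA, rfl⟩
  -- The part of the limit on the level-`ℓ` sheet through `x`, over the base points whose lift to
  -- that sheet lies in `A`. The sheet label is constant along paths over `U`, whence saturation.
  let O' : Set S.Limit := {y | ∃ h : S.proj y ∈ U, S.proj y ∈ Subtype.val '' (σ ⁻¹' A) ∧
    (H ⟨y.1 ℓ, hqx y h⟩).2 = f}
  have hval : Continuous fun y : S.proj ⁻¹' U => (H ⟨y.1.1 ℓ, hqx y.1 y.2⟩).2 :=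
    continuous_snd.comp (H.continuous.comp
      (((S.continuous_eval ℓ).comp continuous_subtype_val).subtype_mk _))
  refine ⟨_, hNo.mem_nhds hxN, O', ?_, ?_, ?_⟩
  · have hUo : IsOpen (S.proj ⁻¹' U) := hU.preimage S.continuous_proj
    have h1 : IsOpen (Subtype.val '' ((fun y : S.proj ⁻¹' U => (H ⟨y.1.1 ℓ, hqx y.1 y.2⟩).2) ⁻¹'
        {f})) := hUo.isOpenMap_subtype_val _ ((isOpen_discrete {f}).preimage hval)
    refine Filter.mem_of_superset (Filter.inter_mem (h1.mem_nhds ⟨⟨x, hxU⟩, rfl, rfl⟩)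
      ((hNo.preimage S.continuous_proj).mem_nhds hxN)) ?_
    rintro _ ⟨⟨y, hy, rfl⟩, hyN⟩
    exact ⟨y.2, hyN, hy⟩
  · rintro y ⟨hy, ⟨b, hb, hby⟩, hf⟩
    have hb' : b = ⟨S.proj y, hy⟩ := Subtype.ext hby
    refine hAO y ?_
    rw [← hsec y hy hf, ← hb']
    exact hb
  · rintro y ⟨hy, hyN, hf⟩ z ⟨p, hp⟩
    refine ⟨p, fun t => ⟨hNU (hp t), hp t, ?_⟩⟩
    have hcont : Continuous fun t => (H ⟨(p t).1 ℓ, hqx (p t) (hNU (hp t))⟩).2 :=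
      hval.comp (f := fun t => (⟨p t, hNU (hp t)⟩ : S.proj ⁻¹' U)) (by fun_prop)
    have := PreconnectedSpace.constant inferInstance hcont (x := t) (y := 0)
    rw [this, ← hf]
    simp

/-- In a compact limit, points with the same coordinate at a high level are close. -/
theorem exists_level_of_isOpen [CompactSpace S.Limit] [∀ ℓ, T2Space (S.E ℓ)]
    {D : Set (S.Limit × S.Limit)} (hD : IsOpen D) (hdiag : ∀ x, (x, x) ∈ D) :
    ∃ k, ∀ x y : S.Limit, x.1 k = y.1 k → (x, y) ∈ D := by
  by_contra! hcon
  -- If no level works, these nested nonempty compact sets have a common point, which agrees in all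
  -- coordinates and so is a diagonal point outside `D`.
  let Z : ℕ → Set (S.Limit × S.Limit) := fun k => {z | z.1.1 k = z.2.1 k} ∩ Dᶜ
  have hZc : ∀ k, IsClosed (Z k) := fun k =>
    (isClosed_eq ((S.continuous_eval k).comp continuous_fst)
      ((S.continuous_eval k).comp continuous_snd)).inter hD.isClosed_compl
  obtain ⟨⟨x, y⟩, hxy⟩ := IsCompact.nonempty_iInter_of_sequence_nonempty_isCompact_isClosed Z
    (fun k => by
      rintro z ⟨hz, hzD⟩
      exact ⟨eval_eq_of_le k.le_succ hz, hzD⟩)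
    (fun k => by
      obtain ⟨x, y, h, h'⟩ := hcon k
      exact ⟨(x, y), h, h'⟩) (hZc 0).isCompact hZc
  have hmem := Set.mem_iInter.1 hxy
  have : x = y := Subtype.ext (funext fun k => (hmem k).1)
  subst this
  exact (hmem 0).2 (hdiag x)

end CoveringTower

/-! ### The intertwining injection. -/

namespace CoveringTower

/-- A homeomorphism between the limits of two towers induces, on the points of a fiber that share
a coordinate of high level with a given point, an injection into a fiber of the other tower that
intertwines the monodromies of the two towers. -/
theorem exists_intertwining {B : Type u} {C : Type v} [TopologicalSpace B] [TopologicalSpace C]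
    (S : CoveringTower B) (R : CoveringTower C) (h : S.Limit ≃ₜ R.Limit) [CompactSpace B]
    [T2Space B] [PathConnectedSpace B] [CompactSpace R.Limit] [∀ ℓ, T2Space (S.E ℓ)]
    [∀ ℓ, T2Space (R.E ℓ)]
    (hB : HasPathTrivialBasis B) (hC : HasPathTrivialBasis C) (b₀ : B) (c₀ : C)
    (s : R.Fiber c₀) :
    ∃ (k : ℕ) (φ : R.Fiber c₀ → S.Fiber b₀), Set.InjOn φ {t | R.coord t k = R.coord s k} ∧
      ∀ g : FundamentalGroup C c₀, (R.isCoveringMap_q k).monodromyPerm c₀ g (R.coord s k) =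
        R.coord s k → ∃ γ : FundamentalGroup B b₀, ∀ t, R.coord t k = R.coord s k →
          φ (R.transport g t) = S.transport γ (φ t) := by
  obtain ⟨𝒱, hopen, hconn, htriv, hbasis⟩ := hB.exists_fine_family
  obtain ⟨W, -, hcW, hWo, -, hW⟩ := hC c₀ Set.univ Filter.univ_mem
  let a : R.Fiber c₀ → S.Limit := fun t => h.symm t.1
  have ha : ∀ t, h (a t) = t.1 := fun t => h.apply_symm_apply _
  have hO : h ⁻¹' (R.proj ⁻¹' W) ∈ 𝓝 (a s) := by
    refine ((hWo.preimage R.continuous_proj).preimage h.continuous).mem_nhds ?_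
    rw [Set.mem_preimage, ha, Set.mem_preimage, s.2]
    exact hcW
  obtain ⟨N, hN, O', hO', hO'O, hsat⟩ := S.exists_saturated_nhds hO
  obtain ⟨U, hU, hxU, hUN⟩ := hbasis (S.proj (a s)) N hN
  have hO'' : interior O' ∩ S.proj ⁻¹' U ∈ 𝓝 (a s) :=
    Filter.inter_mem (interior_mem_nhds.2 hO')
      (((hopen U hU).preimage S.continuous_proj).mem_nhds hxU)
  -- Both requirements hold on an open neighborhood of the diagonal: the first keeps transported
  -- lifts close at all times, the second places `T` near `a s`.
  obtain ⟨k, hk⟩ : ∃ k, ∀ x y : R.Limit, x.1 k = y.1 k →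
      (∃ V ∈ 𝒱, S.proj (h.symm x) ∈ V ∧ S.proj (h.symm y) ∈ V) ∧
      (h.symm y = a s → h.symm x ∈ interior O' ∩ S.proj ⁻¹' U) := by
    have h1 : Continuous fun z : R.Limit × R.Limit => S.proj (h.symm z.1) :=
      S.continuous_proj.comp (h.symm.continuous.comp continuous_fst)
    have h2 : Continuous fun z : R.Limit × R.Limit => S.proj (h.symm z.2) :=
      S.continuous_proj.comp (h.symm.continuous.comp continuous_snd)
    let D : Set (R.Limit × R.Limit) := (⋃ V ∈ 𝒱,
      (fun z : R.Limit × R.Limit => S.proj (h.symm z.1)) ⁻¹' V ∩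
        (fun z : R.Limit × R.Limit => S.proj (h.symm z.2)) ⁻¹' V) ∩
      ({z : R.Limit × R.Limit | h.symm z.2 = a s}ᶜ ∪
        (fun z : R.Limit × R.Limit => h.symm z.1) ⁻¹' (interior O' ∩ S.proj ⁻¹' U))
    have hD : IsOpen D := by
      refine IsOpen.inter ?_ (IsOpen.union ?_ ?_)
      · exact isOpen_biUnion fun V hV =>
          ((hopen V hV).preimage h1).inter ((hopen V hV).preimage h2)
      · exact (isClosed_eq (h.symm.continuous.comp continuous_snd) continuous_const).isOpen_compl
      · exact (isOpen_interior.inter ((hopen U hU).preimage S.continuous_proj)).preimage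
          (h.symm.continuous.comp continuous_fst)
    have hdiag : ∀ x, (x, x) ∈ D := by
      intro x
      refine ⟨?_, ?_⟩
      · obtain ⟨V, hV, hxV, -⟩ := hbasis (S.proj (h.symm x)) Set.univ Filter.univ_mem
        exact Set.mem_iUnion₂.2 ⟨V, hV, hxV, hxV⟩
      · by_cases hx : h.symm x = a s
        · refine Or.inr ?_
          rw [Set.mem_preimage, hx]
          exact mem_of_mem_nhds hO''
        · exact Or.inl hx
    obtain ⟨k, hk⟩ := R.exists_level_of_isOpen hD hdiag
    refine ⟨k, fun x y hxy => ⟨?_, fun hy => (hk x y hxy).2.resolve_left (not_not_intro hy)⟩⟩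
    obtain ⟨V, hV, h'⟩ := Set.mem_iUnion₂.1 (hk x y hxy).1
    exact ⟨V, hV, h'⟩
  have hTO : ∀ t : R.Fiber c₀, R.coord t k = R.coord s k → a t ∈ O' ∧ S.proj (a t) ∈ U := by
    intro t ht
    have := (hk t.1 s.1 (congrArg Subtype.val ht)).2 rfl
    exact ⟨interior_subset this.1, this.2⟩
  obtain ⟨α⟩ : Nonempty (Path (S.proj (a s)) b₀) := PathConnectedSpace.joined _ _
  have hφ : ∀ t : R.Fiber c₀, ∃ y : S.Fiber b₀, R.coord t k = R.coord s k →
      ∃ z, S.proj z = S.proj (a s) ∧ JoinedIn (S.proj ⁻¹' U) (a t) z ∧ S.Lifts α z y.1 := by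
    intro t
    by_cases ht : R.coord t k = R.coord s k
    · obtain ⟨z, hz, hj⟩ := S.exists_joinedIn ((hconn U hU).joinedIn _ (hTO t ht).2 _ hxU)
      obtain ⟨y, hy⟩ := S.exists_lifts α hz
      exact ⟨⟨y, hy.target⟩, fun _ => ⟨z, hz, hj, hy⟩⟩
    · obtain ⟨y, hy⟩ := S.exists_lifts α rfl
      exact ⟨⟨y, hy.target⟩, fun h => absurd h ht⟩
  choose φ hφ using hφ
  refine ⟨k, φ, ?_, ?_⟩
  -- Equal images force equal intermediate points `z`, so `a t` and `a t'` are joined over `U`.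
  -- Saturation keeps this path in `O'`; its image under `h` stays over `W`, where `eq_of_joinedIn`
  -- applies.
  · intro t ht t' ht' heq
    obtain ⟨z, hz, hj, hl⟩ := hφ t ht
    obtain ⟨z', hz', hj', hl'⟩ := hφ t' ht'
    rw [← heq] at hl'
    obtain rfl := hl.left_unique hl'
    have hjO := (hsat _ (hTO t ht).1 _
      ((hj.trans hj'.symm).mono (Set.preimage_mono hUN))).mono hO'O
    have hjR := hjO.image_of_continuous h.continuous (A' := R.proj ⁻¹' W) fun x hx => hx
    rw [ha, ha] at hjR
    exact Subtype.ext (eq_of_joinedIn hW hjR (t.2.trans t'.2.symm))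
  · intro g hg
    obtain ⟨c⟩ := g
    let g : FundamentalGroup C c₀ := Path.Homotopic.Quotient.mk c
    have hgT : ∀ t, R.coord t k = R.coord s k → R.coord (R.transport g t) k = R.coord s k := by
      intro t ht
      rw [R.coord_transport, ht]
      exact hg
    obtain ⟨ps, hps⟩ := R.lifts_transport c s
    let d : Path (S.proj (a s)) (S.proj (a (R.transport g s))) :=
      (ps.map h.symm.continuous).map S.continuous_proj
    obtain ⟨u, hu⟩ := (hconn U hU).joinedIn _ (hTO _ (hgT s rfl)).2 _ hxU
    -- The loop is built from the lift at `s` alone: back along `α`, along the transported lift `d`,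
    -- back inside `U` by `u`, and out along `α`. Closeness makes it work for every `t`.
    refine ⟨Path.Homotopic.Quotient.mk (α.symm.trans ((d.trans u).trans α)), fun t ht => ?_⟩
    obtain ⟨pt, hpt⟩ := R.lifts_transport c t
    obtain ⟨z, hz, hj, hl⟩ := hφ t ht
    obtain ⟨z', hz', hj', hl'⟩ := hφ _ (hgT t ht)
    obtain ⟨β, p, hp⟩ := S.exists_lifts d hz
    obtain ⟨V, hV, hjV⟩ := joinedIn_target_of_close hopen hconn htriv p
      (pt.map h.symm.continuous) (fun τ => by
        rw [hp]
        exact (hk _ _ (eval_eq_of_lifts hps hpt (congrArg Subtype.val ht).symm τ)).1)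
      ⟨U, hU, hj.symm⟩
    obtain ⟨β', hβ'⟩ := S.exists_lifts u (Lifts.target ⟨p, hp⟩)
    have hββ' := hβ'.joinedIn hu
    -- Following `d` and `u` from `z` must end at the point used to define `φ` at the moved point:
    -- both lie over the same base point and are joined over the path-trivial set `V ∪ U`.
    have hz'β : β' = z' := by
      refine eq_of_joinedIn (htriv V hV U hU ⟨_, hjV.target_mem, hj'.source_mem⟩)
        (((hββ'.symm.mono ?_).trans (hjV.mono ?_)).trans (hj'.mono ?_)) (hβ'.target.trans hz'.symm)
      · exact Set.preimage_mono Set.subset_union_right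
      · exact Set.preimage_mono Set.subset_union_left
      · exact Set.preimage_mono Set.subset_union_right
    subst hz'β
    exact (S.transport_eq_of_lifts (hl.symm.trans
      ((Lifts.trans ⟨p, hp⟩ hβ').trans hl'))).symm

end CoveringTower

/-! ### Monodromy of a single covering. -/

namespace IsCoveringMap

variable {B E : Type*} [TopologicalSpace B] [TopologicalSpace E] {q : E → B}

theorem monodromyPerm_mk_eq (hq : IsCoveringMap q) {b : B} (c : Path b b) {e e' : q ⁻¹' {b}}
    (r : Path e.1 e'.1) (hr : ∀ t, q (r t) = c t) : hq.monodromyPerm b (.mk c) e = e' := by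
  have h0 : c 0 = q e.1 := c.source.trans e.2.symm
  have key := (hq.eq_liftPath_iff (γ_0 := h0) (Γ := r)).2
    ⟨r.continuous, funext hr, r.source⟩
  exact Subtype.ext ((congrFun key 1).symm.trans r.target)

theorem exists_path_of_monodromyPerm_mk_eq (hq : IsCoveringMap q) {b : B} (c : Path b b)
    {e e' : q ⁻¹' {b}} (h : hq.monodromyPerm b (.mk c) e = e') :
    ∃ r : Path e.1 e'.1, ∀ t, q (r t) = c t := by
  have h0 : c 0 = q e.1 := c.source.trans e.2.symm
  exact ⟨⟨hq.liftPath c e.1 h0, hq.liftPath_zero _ _ _, congrArg Subtype.val h⟩,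
    fun t => congrFun (hq.liftPath_lifts _ _ h0) t⟩

theorem exists_monodromyPerm_eq [PathConnectedSpace E] (hq : IsCoveringMap q) {b : B}
    (e e' : q ⁻¹' {b}) : ∃ γ, hq.monodromyPerm b γ e = e' := by
  obtain ⟨r⟩ := PathConnectedSpace.joined e.1 e'.1
  have he : q e.1 = b := e.2
  have he' : q e'.1 = b := e'.2
  exact ⟨_, hq.monodromyPerm_mk_eq ((r.map hq.continuous).cast he.symm he'.symm) r fun t => rfl⟩

theorem finite_fiber [CompactSpace E] [T1Space B] (hq : IsCoveringMap q) (b : B) :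
    Finite (q ⁻¹' {b}) := by
  have := (hq b).1
  have : CompactSpace (q ⁻¹' {b}) :=
    isCompact_iff_compactSpace.1 (isClosed_singleton.preimage hq.continuous).isCompact
  exact finite_of_compact_of_discrete

theorem finiteIndex_stabilizer [CompactSpace E] [T1Space B] (hq : IsCoveringMap q) {b : B}
    (e : q ⁻¹' {b}) :
    ((MulAction.stabilizer (Equiv.Perm (q ⁻¹' {b})) e).comap (hq.monodromyPerm b)).FiniteIndex := by
  have := hq.finite_fiber b
  refine ⟨?_⟩
  rw [Subgroup.index_comap]
  exact Subgroup.index_ne_zero_of_finite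

end IsCoveringMap

theorem FundamentalGroup.mapOfEq_mk {X Y : Type*} [TopologicalSpace X] [TopologicalSpace Y]
    (f : C(X, Y)) {x : X} {y : Y} (h : f x = y) (r : Path x x) :
    FundamentalGroup.mapOfEq f h (.mk r) = .mk ((r.map f.continuous).cast h.symm h.symm) := by
  rw [FundamentalGroup.mapOfEq_apply]
  rfl

/-! ### Virtual class bounds and pull-backs of towers. -/

namespace CoveringTower

variable {B : Type u} [TopologicalSpace B] (S : CoveringTower B)

/-- A finite-index subgroup of the fundamental group acts on the fiber over `b` through a nilpotent
group of class at most `n`. -/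
def HasVirtualClassLE (b : B) (n : ℕ) : Prop :=
  ∃ H : Subgroup (FundamentalGroup B b), H.FiniteIndex ∧
    H.lowerCentralSeries n ≤ (S.monodromy b).ker

variable {S}

theorem mem_ker_monodromy_iff {b : B} {γ : FundamentalGroup B b} :
    γ ∈ (S.monodromy b).ker ↔ ∀ x, S.transport γ x = x :=
  ⟨fun h x => congrArg (fun f : S.Fiber b ≃ₜ S.Fiber b => f x) h, fun h => Homeomorph.ext h⟩

/-- Virtual nilpotency of the monodromy, with a bound on the class, is invariant under
homeomorphisms of the limits, and independent of the base points. -/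
theorem HasVirtualClassLE.of_homeomorph {C : Type v} [TopologicalSpace C]
    {R : CoveringTower C} (h : S.Limit ≃ₜ R.Limit) [CompactSpace B]
    [T2Space B] [PathConnectedSpace B] [CompactSpace R.Limit] [∀ ℓ, T2Space (S.E ℓ)]
    [T1Space C] [∀ ℓ, T2Space (R.E ℓ)] [∀ ℓ, CompactSpace (R.E ℓ)]
    [∀ ℓ, PathConnectedSpace (R.E ℓ)]
    (hB : HasPathTrivialBasis B) (hC : HasPathTrivialBasis C) {b₀ : B} (c₀ : C) {n : ℕ}
    (hS : S.HasVirtualClassLE b₀ n) : R.HasVirtualClassLE c₀ n := by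
  obtain ⟨H, hH, hn⟩ := hS
  rcases isEmpty_or_nonempty (R.Fiber c₀) with hemp | ⟨⟨s⟩⟩
  · exact ⟨⊤, inferInstance, fun g _ => mem_ker_monodromy_iff.2 fun x => isEmptyElim x⟩
  obtain ⟨k, φ, hinj, hφ⟩ := S.exists_intertwining R h hB hC b₀ c₀ s
  let _ : MulAction (FundamentalGroup B b₀) (S.Fiber b₀) :=
    { smul := S.transport, one_smul := S.transport_one, mul_smul := S.transport_mul }
  let _ : MulAction (FundamentalGroup C c₀) (R.Fiber c₀) :=
    { smul := R.transport, one_smul := R.transport_one, mul_smul := R.transport_mul }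
  obtain ⟨H', hH', hn'⟩ := exists_finiteIndex_lowerCentralSeries_smul_eq _
    ((R.isCoveringMap_q k).finiteIndex_stabilizer (R.coord s k))
    {t | R.coord t k = R.coord s k} (fun g hg t ht => by
      change R.coord (R.transport g t) k = _
      rw [R.coord_transport, show R.coord t k = R.coord s k from ht]
      exact hg) φ hinj (fun g hg => hφ g hg) H hH n
      (fun γ hγ x => mem_ker_monodromy_iff.1 (hn hγ) x)
      (fun y => (R.isCoveringMap_q k).exists_monodromyPerm_eq (R.coord y k) (R.coord s k))
  exact ⟨H', hH', fun g hg => mem_ker_monodromy_iff.2 fun x => hn' g hg x⟩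

/-- If the bonding maps are surjective, the finite-index subgroup acting nilpotently on the fiber of
the limit can be chosen to be the kernel of the monodromy on some level. -/
theorem HasVirtualClassLE.exists_level (hp : ∀ ℓ, Function.Surjective (S.p ℓ)) {b : B} {n : ℕ}
    (hS : S.HasVirtualClassLE b n) : ∃ k,
      ((S.isCoveringMap_q k).monodromyPerm b).ker.lowerCentralSeries n ≤ (S.monodromy b).ker := by
  obtain ⟨H, hH, hn⟩ := hS
  obtain ⟨k, hk⟩ := exists_le_sup_of_antitone H hH
    -- Surjectivity of the bonding maps makes these kernels decrease: a loop acting trivially on one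
    -- level does so on the level below.
    (fun m => ((S.isCoveringMap_q m).monodromyPerm b).ker) (antitone_nat_of_succ_le fun m g hg => by
      refine Equiv.ext fun e => Subtype.ext ?_
      obtain ⟨e', he'⟩ := hp m e.1
      have hqe' : S.q (m + 1) e' = b := by
        rw [← S.q_comp_p m, Function.comp_apply, he']
        exact e.2
      have := S.p_monodromy g m ⟨e', hqe'⟩ e he'
      rw [show (S.isCoveringMap_q (m + 1)).monodromyPerm b g = 1 from hg] at this
      exact this.symm.trans he')
  refine ⟨k, fun d hd => mem_ker_monodromy_iff.2 fun x => S.coord_ext fun m => ?_⟩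
  -- Modulo the level-`m` kernel, the level-`k` kernel is contained in `H`. So `d` acts on level `m`
  -- like some element of the `n`-th term of `H`, although that element may depend on `m`.
  have h1 : (S.isCoveringMap_q m).monodromyPerm b d ∈
      (H.lowerCentralSeries n).map ((S.isCoveringMap_q m).monodromyPerm b) := by
    rw [Subgroup.map_lowerCentralSeries]
    have h2 := Subgroup.mem_map_of_mem ((S.isCoveringMap_q m).monodromyPerm b)
      (Subgroup.lowerCentralSeries_mono n (hk m) hd)
    rwa [Subgroup.map_lowerCentralSeries, Subgroup.map_sup,
      (Subgroup.map_eq_bot_iff _).2 le_rfl, sup_bot_eq] at h2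
  obtain ⟨g, hg, hgd⟩ := h1
  rw [S.coord_transport, ← hgd, ← S.coord_transport, mem_ker_monodromy_iff.1 (hn hg)]

variable {B' : Type u} [TopologicalSpace B'] (S)

/-- The map between fibers induced by the projection of the pull-back of a tower. -/
def pullbackFiber (f : C(B', B)) (b : B') (z : (S.pullback f).Fiber b) : S.Fiber (f b) :=
  ⟨(S.pullbackHomeomorph f z.1).1.2,
    (S.pullbackHomeomorph f z.1).2.symm.trans (congrArg f z.2)⟩

theorem pullbackFiber_bijective (f : C(B', B)) (b : B') :
    Function.Bijective (S.pullbackFiber f b) := by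
  refine ⟨fun z w h => ?_, fun y => ?_⟩
  · refine Subtype.ext ((S.pullbackHomeomorph f).injective (Subtype.ext (Prod.ext ?_ ?_)))
    · exact Eq.trans z.2 (Eq.symm w.2)
    · exact congrArg Subtype.val h
  · exact ⟨⟨(S.pullbackHomeomorph f).symm ⟨(b, y.1), Eq.symm y.2⟩, rfl⟩, rfl⟩

theorem pullbackFiber_transport (f : C(B', B)) (b : B') (γ : FundamentalGroup B' b)
    (z : (S.pullback f).Fiber b) :
    S.pullbackFiber f b ((S.pullback f).transport γ z) =
      S.transport (FundamentalGroup.mapOfEq f rfl γ) (S.pullbackFiber f b z) := by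
  obtain ⟨c⟩ := γ
  refine Eq.symm ?_
  refine (congrArg (fun g => S.transport g _) (FundamentalGroup.mapOfEq_mk f rfl c)).trans ?_
  obtain ⟨r, hr⟩ := (S.pullback f).lifts_transport c z
  refine S.transport_eq_of_lifts ⟨(r.map (S.pullbackHomeomorph f).continuous).map
    (continuous_snd.comp continuous_subtype_val), fun t => ?_⟩
  exact (S.pullbackHomeomorph f (r t)).2.symm.trans (congrArg f (hr t))

theorem ker_pullback_monodromy (f : C(B', B)) (b : B') :
    ((S.pullback f).monodromy b).ker =
      (S.monodromy (f b)).ker.comap (FundamentalGroup.mapOfEq f rfl) := by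
  ext γ
  rw [Subgroup.mem_comap, mem_ker_monodromy_iff, mem_ker_monodromy_iff,
    (S.pullbackFiber_bijective f b).2.forall]
  refine forall_congr' fun z => ?_
  rw [← S.pullbackFiber_transport, (S.pullbackFiber_bijective f b).1.eq_iff]

/-- The pulled-back fiber is equivariantly the original one, so the monodromy upstairs is that of
`H` downstairs, whichever associated cover is used. -/
theorem lowerCentralSeries_range_pullback_eq_bot_iff {b : B}
    {H : Subgroup (FundamentalGroup B b)} (c : AssociatedCover b H) (n : ℕ) :
    ((S.pullback c.proj).monodromy c.basepoint).range.lowerCentralSeries n = ⊥ ↔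
      H.lowerCentralSeries n ≤ (S.monodromy b).ker := by
  obtain ⟨C, f, hf, c₀, hc, hH⟩ := c
  subst hc
  subst hH
  change ((S.pullback f).monodromy c₀).range.lowerCentralSeries n = ⊥ ↔ _
  rw [(S.pullback f |>.monodromy c₀).range_eq_map, ← Subgroup.map_lowerCentralSeries,
    Subgroup.map_eq_bot_iff, ker_pullback_monodromy, ← Subgroup.map_le_iff_le_comap,
    Subgroup.map_lowerCentralSeries, ← MonoidHom.range_eq_map]

end CoveringTower

/-! ### Construction of associated covers. -/

theorem IsLocalHomeomorph.locallyConnectedSpace {X Y : Type*} [TopologicalSpace X]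
    [TopologicalSpace Y] [LocallyConnectedSpace Y] {f : X → Y} (hf : IsLocalHomeomorph f) :
    LocallyConnectedSpace X := by
  choose φ hφ _ using hf
  let _ : ChartedSpace Y X :=
    { atlas := Set.range φ
      chartAt := φ
      mem_chart_source := hφ
      chart_mem_atlas := fun x => ⟨x, rfl⟩ }
  exact ChartedSpace.locallyConnectedSpace Y X

namespace IsCoveringMap

variable {B E : Type u} [TopologicalSpace B] [TopologicalSpace E] {q : E → B}

/-- For any finite set of points in the fiber of a covering map `q` of compact Hausdorff spaces
there is a pointed compact covering space (an iterated fiber product) whose loops lift to loops at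
these points. -/
theorem exists_compact_cover_lifting_loops [CompactSpace B] [T2Space B] [CompactSpace E]
    [T2Space E] (hq : IsCoveringMap q) (b : B) (F : Finset (q ⁻¹' {b})) :
    ∃ (C : Type u) (_ : TopologicalSpace C) (_ : CompactSpace C) (_ : T2Space C) (f : C(C, B))
      (c : C), f c = b ∧ IsCoveringMap f ∧
        ∀ (r : Path c c), ∀ e ∈ F, ∃ r' : Path e.1 e.1, ∀ t, q (r' t) = f (r t) := by
  classical
  induction F using Finset.induction_on with
  | empty =>
    exact ⟨B, inferInstance, inferInstance, inferInstance, .id B, b, rfl,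
      isLocalHomeomorph_iff_isCoveringMap.1 (Homeomorph.refl B).isLocalHomeomorph, fun r e he => absurd he (Finset.notMem_empty e)⟩
  | insert e F he ih =>
    obtain ⟨C, _, _, _, f, c, hc, hf, hl⟩ := ih
    have hcl : IsClosed {z : C × E | f z.1 = q z.2} :=
      isClosed_eq (f.continuous.comp continuous_fst) (hq.continuous.comp continuous_snd)
    have hcomp : CompactSpace (Function.Pullback f q) :=
      isCompact_iff_compactSpace.1 hcl.isCompact
    have hT2 : T2Space (Function.Pullback f q) :=
      inferInstanceAs (T2Space {z : C × E // f z.1 = q z.2})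
    -- A loop at `(c, e)` in the fiber product has a second coordinate that is itself a closed lift
    -- at `e`.
    refine ⟨Function.Pullback f q, inferInstance, hcomp, hT2,
      f.comp ⟨fun z => z.1.1, continuous_fst.comp continuous_subtype_val⟩,
      ⟨(c, e.1), hc.trans (Eq.symm e.2)⟩, hc, ?_, fun r e' he' => ?_⟩
    · rw [← isLocalHomeomorph_iff_isCoveringMap]
      exact hf.isLocalHomeomorph.comp (isCoveringMap_pullback_fst f hq).isLocalHomeomorph
    · rcases Finset.mem_insert.1 he' with rfl | he'
      · exact ⟨r.map (continuous_snd.comp continuous_subtype_val), fun t => (r t).2.symm⟩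
      · exact hl (r.map (continuous_fst.comp continuous_subtype_val)) e' he'

/-- The image of the fundamental group of a covering space contains the stabilizer of its base
point. -/
theorem stabilizer_le_range_mapOfEq {f : C(E, B)} (hf : IsCoveringMap f) {c : E} {b : B}
    (hc : f c = b) :
    (MulAction.stabilizer (Equiv.Perm (f ⁻¹' {b})) (⟨c, hc⟩ : f ⁻¹' {b})).comap (hf.monodromyPerm b) ≤
      (FundamentalGroup.mapOfEq f hc).range := by
  intro γ hp
  obtain ⟨p, rfl⟩ : ∃ p : Path b b, FundamentalGroup.fromPath (.mk p) = γ := Quot.exists_rep γ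
  obtain ⟨r, hr⟩ := hf.exists_path_of_monodromyPerm_mk_eq p hp
  have hrp : (r.map f.continuous).cast hc.symm hc.symm = p := Path.ext (funext hr)
  have key := FundamentalGroup.mapOfEq_mk f hc r
  rw [hrp] at key
  exact MonoidHom.mem_range.2 ⟨_, key⟩

/-- A covering map of compact Hausdorff spaces over a locally connected base is trivialized by a
pointed connected covering space associated to a subgroup of finite index. -/
theorem exists_associatedCover_le_ker [CompactSpace B] [T2Space B] [LocallyConnectedSpace B]
    [CompactSpace E] [T2Space E] (hq : IsCoveringMap q) (b : B) :
    ∃ H : Subgroup (FundamentalGroup B b), H.FiniteIndex ∧ H ≤ (hq.monodromyPerm b).ker ∧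
      Nonempty (AssociatedCover b H) := by
  have := hq.finite_fiber b
  have := Fintype.ofFinite (q ⁻¹' {b})
  obtain ⟨C, _, _, _, f, c, hc, hf, hl⟩ := hq.exists_compact_cover_lifting_loops b Finset.univ
  have : LocallyConnectedSpace C := hf.isLocalHomeomorph.locallyConnectedSpace
  -- Local connectedness makes the component open, so restricting to it preserves the local
  -- homeomorphism; compactness then makes it a covering of finite degree.
  let g : C(connectedComponent c, B) := f.comp ⟨Subtype.val, continuous_subtype_val⟩
  have : CompactSpace (connectedComponent c) :=
    isCompact_iff_compactSpace.1 isClosed_connectedComponent.isCompact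
  have : ConnectedSpace (connectedComponent c) :=
    isConnected_iff_connectedSpace.1 isConnected_connectedComponent
  have hg : IsCoveringMap g := by
    rw [← isLocalHomeomorph_iff_isCoveringMap]
    exact hf.isLocalHomeomorph.comp
      isOpen_connectedComponent.isOpenEmbedding_subtypeVal.isLocalHomeomorph
  have hgc : g ⟨c, mem_connectedComponent⟩ = b := hc
  refine ⟨(FundamentalGroup.mapOfEq g hgc).range, ?_, ?_, ⟨⟨_, g, hg, _, hgc, rfl⟩⟩⟩
  · have := hg.finiteIndex_stabilizer ⟨_, hgc⟩
    exact Subgroup.finiteIndex_of_le (IsCoveringMap.stabilizer_le_range_mapOfEq hg hgc)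
  · rintro _ ⟨⟨r⟩, rfl⟩
    refine Equiv.ext fun e => ?_
    obtain ⟨r', hr'⟩ := hl (r.map continuous_subtype_val) e (Finset.mem_univ e)
    refine (congrArg (fun γ => hq.monodromyPerm b γ e)
      (FundamentalGroup.mapOfEq_mk g hgc r)).trans ?_
    exact hq.monodromyPerm_mk_eq _ r' hr'

end IsCoveringMap

/-! ### Application to weak solenoids. -/

namespace WeakSolenoidPresentation

variable (P : WeakSolenoidPresentation.{u})

theorem surjective_p (ℓ : ℕ) : Function.Surjective (P.p ℓ) := by
  intro y
  have h : Nat.card (P.p ℓ ⁻¹' {y}) ≠ 0 := by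
    rw [P.card_fiber]
    exact (zero_lt_one.trans (P.one_lt_degree ℓ)).ne'
  obtain ⟨⟨x, hx⟩⟩ := (Nat.card_ne_zero.1 h).1
  exact ⟨x, hx⟩

theorem pathConnectedSpace (ℓ : ℕ) : PathConnectedSpace (P.M ℓ) := by
  have : LocallyPathConnectedSpace (P.M ℓ) :=
    ChartedSpace.locallyPathConnectedSpace (EuclideanSpace ℝ (Fin P.dim)) (P.M ℓ)
  exact .of_locallyPathConnectedSpace

theorem compactSpace_solenoid : CompactSpace P.Solenoid := by
  have hE : ∀ ℓ, CompactSpace (P.tower.E ℓ) := P.compactM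
  have hT : ∀ ℓ, T2Space (P.tower.E ℓ) := P.t2M
  refine isCompact_iff_compactSpace.1 (IsClosed.isCompact ?_)
  change IsClosed {x : ∀ ℓ, P.tower.E ℓ | ∀ ℓ, P.tower.p ℓ (x (ℓ + 1)) = x ℓ}
  rw [Set.ofPred_forall]
  exact isClosed_iInter fun ℓ => isClosed_eq
    ((P.tower.continuous_p ℓ).comp (continuous_apply (ℓ + 1))) (continuous_apply ℓ)

variable {P}

/-- In the converse direction the given subgroup is discarded: a cover is constructed only for a
finite-index subgroup of a level kernel, and passing to a subgroup keeps the class bound. -/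
theorem exists_associatedCover_iff (x₀ : P.M 0) (n : ℕ) :
    (∃ H : Subgroup (FundamentalGroup (P.M 0) x₀), H.FiniteIndex ∧ ∃ c : AssociatedCover x₀ H,
      ((P.tower.pullback c.proj).monodromy c.basepoint).range.lowerCentralSeries n = ⊥) ↔
    P.tower.HasVirtualClassLE x₀ n := by
  constructor
  · rintro ⟨H, hH, c, hc⟩
    exact ⟨H, hH, (P.tower.lowerCentralSeries_range_pullback_eq_bot_iff c n).1 hc⟩
  · intro h
    obtain ⟨k, hk⟩ := h.exists_level P.surjective_p
    have : LocallyConnectedSpace (P.M 0) :=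
      ChartedSpace.locallyConnectedSpace (EuclideanSpace ℝ (Fin P.dim)) (P.M 0)
    obtain ⟨H, hH, hle, ⟨c⟩⟩ := (P.isCoveringMap_q k).exists_associatedCover_le_ker x₀
    exact ⟨H, hH, c, (P.tower.lowerCentralSeries_range_pullback_eq_bot_iff c n).2
      ((Subgroup.lowerCentralSeries_mono n hle).trans hk)⟩

theorem isVirtuallyNilpotent_iff (x₀ : P.M 0) :
    P.IsVirtuallyNilpotent x₀ ↔ ∃ n, P.tower.HasVirtualClassLE x₀ n := by
  simp only [← exists_associatedCover_iff]
  constructor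
  · rintro ⟨H, hH, c, hc⟩
    obtain ⟨n, hn⟩ := (Subgroup.isNilpotent_iff_lowerCentralSeries _).1 hc
    exact ⟨n, H, hH, c, hn⟩
  · rintro ⟨n, H, hH, c, hn⟩
    exact ⟨H, hH, c, (Subgroup.isNilpotent_iff_lowerCentralSeries _).2 ⟨n, hn⟩⟩

theorem isVirtuallyAbelian_iff (x₀ : P.M 0) :
    P.IsVirtuallyAbelian x₀ ↔ P.tower.HasVirtualClassLE x₀ 1 := by
  rw [← exists_associatedCover_iff]
  refine exists_congr fun H => and_congr_right fun _ => exists_congr fun c => ?_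
  rw [Subgroup.lowerCentralSeries_succ, Subgroup.lowerCentralSeries_zero,
    Subgroup.commutator_eq_bot_iff_le_centralizer]
  exact ⟨fun h g hg k hk => h k hk g hg, fun h g hg k hk => h hk g hg⟩

theorem hasVirtualClassLE_of_homeomorph {P : WeakSolenoidPresentation.{u}}
    {Q : WeakSolenoidPresentation.{v}} (h : P.Solenoid ≃ₜ Q.Solenoid) {x₀ : P.M 0} (y₀ : Q.M 0)
    {n : ℕ} (hP : P.tower.HasVirtualClassLE x₀ n) : Q.tower.HasVirtualClassLE y₀ n := by
  have := Q.compactSpace_solenoid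
  have := P.pathConnectedSpace 0
  have : ∀ ℓ, T2Space (P.tower.E ℓ) := P.t2M
  have : ∀ ℓ, T2Space (Q.tower.E ℓ) := Q.t2M
  have : ∀ ℓ, CompactSpace (Q.tower.E ℓ) := Q.compactM
  have : ∀ ℓ, PathConnectedSpace (Q.tower.E ℓ) := Q.pathConnectedSpace
  exact hP.of_homeomorph h
    (ChartedSpace.hasPathTrivialBasis (EuclideanSpace ℝ (Fin P.dim)) (P.M 0))
    (ChartedSpace.hasPathTrivialBasis (EuclideanSpace ℝ (Fin Q.dim)) (Q.M 0)) y₀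

end WeakSolenoidPresentation

theorem mainTheorem6 (P : WeakSolenoidPresentation.{u}) (Q : WeakSolenoidPresentation.{v})
    (hPQ : Nonempty (P.Solenoid ≃ₜ Q.Solenoid)) (x₀ : P.M 0) (y₀ : Q.M 0) :
    (P.IsVirtuallyNilpotent x₀ ↔ Q.IsVirtuallyNilpotent y₀) ∧
      (P.IsVirtuallyAbelian x₀ ↔ Q.IsVirtuallyAbelian y₀) := by
  obtain ⟨h⟩ := hPQ
  have key : ∀ n, P.tower.HasVirtualClassLE x₀ n ↔ Q.tower.HasVirtualClassLE y₀ n := fun n =>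
    ⟨WeakSolenoidPresentation.hasVirtualClassLE_of_homeomorph h y₀,
      WeakSolenoidPresentation.hasVirtualClassLE_of_homeomorph h.symm x₀⟩
  rw [WeakSolenoidPresentation.isVirtuallyNilpotent_iff,
    WeakSolenoidPresentation.isVirtuallyNilpotent_iff,
    WeakSolenoidPresentation.isVirtuallyAbelian_iff,
    WeakSolenoidPresentation.isVirtuallyAbelian_iff]
  exact ⟨exists_congr key, key 1⟩
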